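/- Let $\mu=p_1\delta_{M_1}+\cdots+p_N\delta_{M_N}$ be a probability distribution on $\mathbb{R}^{n\times n}$, where $p_1,\dots,p_N>0$ and $M_1,\dots,M_N\in\mathbb{R}^{n\times n}$. Let $\mathcal M=\operatorname{supp}\mu$ and let $A$ be a random matrix with law $\mu$. Write $$\hat\rho(\mathcal M)=\limsup_{k\to\infty}\ \sup_{A_1,\dots,A_k\in\mathcal M}\|A_k\cdots A_1\|^{1/k}$$ for the joint spectral radius of $\mathcal M$ (with $\|\cdot\|$ the maximal singular value), $\rho(B)$ for the spectral radius of a real square matrix $B$ (the largest modulus of its complex eigenvalues), and $A^{\otimes p}$ for the $p$-fold Kronecker power of $A$, i.e. $A^{\otimes 1}=A$ and $A^{\otimes p}=A^{\otimes(p-1)}\otimes A$. Then $\hat\rho(\mathcal M)$ is finite and $$\hat\rho(\mathcal M)=\lim_{p\to\infty}\rho\bigl(E[A^{\otimes(2p)}]\bigr)^{1/(2p)}=\limsup_{p\to\infty}\rho\bigl(E[A^{\otimes p}]\bigr)^{1/p},$$ where $p$ runs over the positive integers; in particular the limit exists. -/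

import Mathlib

open MeasureTheory ProbabilityTheory Filter
open scoped ENNReal

noncomputable section

/-- Matrices carry the entrywise product `σ`-algebra. -/
instance instMeasurableSpaceRealMatrix {m n : Type*} : MeasurableSpace (Matrix m n ℝ) :=
  inferInstanceAs (MeasurableSpace (m → n → ℝ))

/-- For countable index types this is the Borel `σ`-algebra. -/
instance instBorelSpaceRealMatrix {m n : Type*} [Countable m] [Countable n] :
    BorelSpace (Matrix m n ℝ) :=
  inferInstanceAs (BorelSpace (m → n → ℝ))

open scoped Matrix.Norms.L2Operator in
/-- The joint spectral radius `limsup_{k → ∞} sup_{A₁, …, A_k ∈ S} ‖A_k ⋯ A₁‖ ^ (1 / k)` of a set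
`S` of real `n × n` matrices, as an extended nonnegative real number. The norm is the maximal
singular value (the `ℓ²` operator norm). The supremum runs over all `k`-tuples in `S`, so the order
in which a tuple is multiplied does not matter. -/
def jointSpectralRadius {n : ℕ} (S : Set (Matrix (Fin n) (Fin n) ℝ)) : ℝ≥0∞ :=
  limsup (fun k : ℕ => ⨆ A : Fin k → S,
    ‖(List.ofFn fun i => (A i : Matrix (Fin n) (Fin n) ℝ)).prod‖ₑ ^ (1 / (k : ℝ))) atTop

/-- The Kronecker power `A^{⊗p}`, an `n^p × n^p` matrix, with `A^{⊗(p+1)} = A^{⊗p} ⊗ A`. The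
recursion starts at `A^{⊗0} = 1` (a `1 × 1` matrix), so that `A^{⊗1} = 1 ⊗ A = A`. -/
def kroneckerPower {n : ℕ} (A : Matrix (Fin n) (Fin n) ℝ) :
    (p : ℕ) → Matrix (Fin (n ^ p)) (Fin (n ^ p)) ℝ
  | 0 => 1
  | p + 1 => Matrix.reindex finProdFinEquiv finProdFinEquiv
      (Matrix.kronecker (kroneckerPower A p) A)

/-- The (entrywise) expectation `E[A^{⊗p}]` of the Kronecker power of a random matrix `A`. -/
def expectedKroneckerPower {n : ℕ} {Ω : Type*} [MeasurableSpace Ω] (P : Measure Ω)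
    (A : Ω → Matrix (Fin n) (Fin n) ℝ) (p : ℕ) : Matrix (Fin (n ^ p)) (Fin (n ^ p)) ℝ :=
  Matrix.of fun i j => ∫ ω, kroneckerPower (A ω) p i j ∂P

/-- The spectral radius of a real square matrix: the largest modulus of its complex eigenvalues. -/
def matrixSpectralRadius {m : ℕ} (B : Matrix (Fin m) (Fin m) ℝ) : ℝ≥0∞ :=
  spectralRadius ℂ (B.map (algebraMap ℝ ℂ))

end

/-! ### Multiplicativity and entries of Kronecker powers -/

section KroneckerPower

variable {n : ℕ}

/-! Put `B_p = E[A^{⊗p}] = ∑ w_i M_i^{⊗p}`. Kronecker powers are multiplicative, so `B_p ^ k` is the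
average of `Q^{⊗p}` over all words `Q` of length `k`, weighted by products of the `w_i`. Let `s_k`
be the largest norm of such a word and `J` the joint spectral radius.

Averaging gives `‖B_p ^ k‖ ≤ D * s_k ^ p`. Conversely, for even `p` the entries `(Q a b) ^ p` of
`Q^{⊗p}` are nonnegative, so no cancellation hides a single word: `v ^ k * s_k ^ p ≤ D' * ‖B_p ^
k‖`, where `v` is the least weight. The constants depend on `p` but not on `k`, so Gelfand's formula
yields `ρ(B_p) ^ (1/p) ≤ J` for all `p > 0` and `v ^ (1/p) * J ≤ ρ(B_p) ^ (1/p)` for even `p > 0`.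
Finally `v ^ (1/p) → 1`. -/

theorem kroneckerPower_one (p : ℕ) :
    kroneckerPower (1 : Matrix (Fin n) (Fin n) ℝ) p = 1 := by
  induction p with
  | zero => rfl
  | succ p ih =>
    rw [kroneckerPower, ih, Matrix.kronecker, Matrix.kroneckerMap_one_one _ (by simp) (by simp)
      (by simp)]
    exact Matrix.submatrix_one_equiv _

theorem kroneckerPower_mul (A B : Matrix (Fin n) (Fin n) ℝ) (p : ℕ) :
    kroneckerPower (A * B) p = kroneckerPower A p * kroneckerPower B p := by
  induction p with
  | zero => exact (one_mul _).symm
  | succ p ih =>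
    simp only [kroneckerPower, ih, Matrix.kronecker, Matrix.mul_kronecker_mul,
      Matrix.reindex_apply]
    exact (Matrix.submatrix_mul_equiv _ _ _ _ _).symm

theorem kroneckerPower_succ_apply (A : Matrix (Fin n) (Fin n) ℝ) (p : ℕ)
    (i j : Fin (n ^ (p + 1))) :
    kroneckerPower A (p + 1) i j =
      kroneckerPower A p (finProdFinEquiv.symm i).1 (finProdFinEquiv.symm j).1 *
        A (finProdFinEquiv.symm i).2 (finProdFinEquiv.symm j).2 := rfl

theorem abs_kroneckerPower_apply_le {A : Matrix (Fin n) (Fin n) ℝ} {c : ℝ}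
    (hA : ∀ i j, |A i j| ≤ c) (p : ℕ) (i j : Fin (n ^ p)) :
    |kroneckerPower A p i j| ≤ c ^ p := by
  induction p with
  | zero =>
    rw [kroneckerPower, Matrix.one_apply]
    split_ifs <;> simp
  | succ p ih =>
    rw [kroneckerPower_succ_apply, abs_mul, pow_succ]
    exact mul_le_mul (ih _ _) (hA _ _) (abs_nonneg _) ((abs_nonneg _).trans (ih i.divNat j.divNat))

/-- The index `(i, …, i)` of the `p`-fold Kronecker power. -/
def kroneckerDiagIndex (i : Fin n) : (p : ℕ) → Fin (n ^ p)
  | 0 => ⟨0, by simp⟩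
  | p + 1 => finProdFinEquiv (kroneckerDiagIndex i p, i)

theorem kroneckerPower_kroneckerDiagIndex (A : Matrix (Fin n) (Fin n) ℝ) (i j : Fin n) (p : ℕ) :
    kroneckerPower A p (kroneckerDiagIndex i p) (kroneckerDiagIndex j p) = A i j ^ p := by
  induction p with
  | zero => exact (Matrix.one_apply_eq _).trans (pow_zero _).symm
  | succ p ih =>
    rw [kroneckerPower_succ_apply, pow_succ]
    simp only [kroneckerDiagIndex, Equiv.symm_apply_apply, ih]

theorem continuous_kroneckerPower_apply (p : ℕ) (i j : Fin (n ^ p)) :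
    Continuous fun A : Matrix (Fin n) (Fin n) ℝ => kroneckerPower A p i j := by
  induction p with
  | zero => exact continuous_const
  | succ p ih =>
    simp only [kroneckerPower_succ_apply]
    exact (ih _ _).mul (continuous_id.matrix_elem _ _)

/-- Noncommutative expansion into words; each product of Kronecker powers collapses to the Kronecker
power of a product. -/
theorem sum_smul_kroneckerPower_pow {N : ℕ} (w : Fin N → ℝ)
    (M : Fin N → Matrix (Fin n) (Fin n) ℝ) (p k : ℕ) :
    (∑ i, w i • kroneckerPower (M i) p) ^ k =
      ∑ f : Fin k → Fin N, (∏ t, w (f t)) •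
        kroneckerPower (List.ofFn fun t => M (f t)).prod p := by
  induction k with
  | zero => simp [kroneckerPower_one]
  | succ k ih =>
    rw [pow_succ', ih, Finset.sum_mul_sum, ← Fintype.sum_prod_type']
    refine Fintype.sum_equiv (Fin.consEquiv fun _ => Fin N) _ _ fun x => ?_
    simp [Fin.prod_univ_succ, List.ofFn_succ, kroneckerPower_mul, smul_smul, mul_comm]

end KroneckerPower

/-! ### Expectation and support of the discrete law -/

section Law

variable {n N : ℕ} {w : Fin N → ℝ} {M : Fin N → Matrix (Fin n) (Fin n) ℝ}

theorem expectedKroneckerPower_eq_sum {μ : Measure (Matrix (Fin n) (Fin n) ℝ)}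
    (hw : ∀ i, 0 < w i) (hμ : μ = ∑ i, ENNReal.ofReal (w i) • Measure.dirac (M i))
    {Ω : Type*} [MeasurableSpace Ω] {P : Measure Ω} {A : Ω → Matrix (Fin n) (Fin n) ℝ}
    (hA : HasLaw A μ P) (p : ℕ) :
    expectedKroneckerPower P A p = ∑ i, w i • kroneckerPower (M i) p := by
  ext a b
  have hc := continuous_kroneckerPower_apply (n := n) p a b
  have h := hA.integral_comp (f := fun B => kroneckerPower B p a b)
    hc.measurable.aestronglyMeasurable
  rw [expectedKroneckerPower, Matrix.of_apply]
  refine h.trans ?_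
  rw [hμ, integral_finsetSum_measure]
  · simp only [Matrix.sum_apply, Matrix.smul_apply, integral_smul_measure]
    refine Finset.sum_congr rfl fun i _ => ?_
    rw [integral_dirac' _ _ hc.measurable.stronglyMeasurable,
      ENNReal.toReal_ofReal (hw i).le]
  · intro i _
    refine Integrable.smul_measure ?_ ENNReal.ofReal_ne_top
    exact (integrable_dirac' hc.measurable.stronglyMeasurable (by simp))

theorem sum_weights_eq_one {μ : Measure (Matrix (Fin n) (Fin n) ℝ)} [IsProbabilityMeasure μ]
    (hw : ∀ i, 0 < w i) (hμ : μ = ∑ i, ENNReal.ofReal (w i) • Measure.dirac (M i)) :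
    ∑ i, w i = 1 := by
  have h : μ Set.univ = 1 := measure_univ
  rw [hμ] at h
  simp only [Measure.coe_finsetSum, Finset.sum_apply, Measure.smul_apply, measure_univ,
    smul_eq_mul, mul_one] at h
  rw [← ENNReal.ofReal_sum_of_nonneg fun i _ => (hw i).le] at h
  simpa using h

theorem support_sum_smul_dirac {μ : Measure (Matrix (Fin n) (Fin n) ℝ)}
    (hw : ∀ i, 0 < w i) (hμ : μ = ∑ i, ENNReal.ofReal (w i) • Measure.dirac (M i)) :
    μ.support = Set.range M := by
  apply Set.Subset.antisymm
  · refine Measure.support_subset_of_isClosed (Set.finite_range M).isClosed ?_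
    rw [mem_ae_iff, hμ]
    have hm : MeasurableSet (Set.range M)ᶜ := (Set.finite_range M).isClosed.measurableSet.compl
    simp [Measure.dirac_apply' _ hm]
  · rintro _ ⟨i, rfl⟩
    rw [Measure.mem_support_iff_forall]
    intro U hU
    rw [hμ]
    simp only [Measure.coe_finsetSum, Finset.sum_apply, Measure.smul_apply, smul_eq_mul]
    refine lt_of_lt_of_le ?_ (Finset.single_le_sum (fun _ _ => zero_le) (Finset.mem_univ i))
    rw [Measure.dirac_apply_of_mem (mem_of_mem_nhds hU), mul_one]
    exact ENNReal.ofReal_pos.2 (hw i)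

end Law

/-! ### Norms of powers of the expectation against norms of words -/

section NormBounds

open scoped Matrix.Norms.L2Operator

theorem Matrix.norm_entry_le_l2_opNorm {𝕜 m n : Type*} [RCLike 𝕜] [Fintype m] [Fintype n]
    [DecidableEq n] (B : Matrix m n 𝕜) (i : m) (j : n) : ‖B i j‖ ≤ ‖B‖ := by
  have h := B.l2_opNorm_mulVec (EuclideanSpace.single j 1)
  rw [PiLp.norm_single, norm_one, mul_one] at h
  refine le_trans ?_ h
  refine le_trans (le_of_eq ?_) (PiLp.norm_apply_le _ i)
  simp

theorem Matrix.exists_l2_opNorm_le_of_entry_le (𝕜 m n : Type*) [RCLike 𝕜] [Fintype m] [Fintype n]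
    [DecidableEq m] [DecidableEq n] :
    ∃ C : ℝ, 0 < C ∧ ∀ (B : Matrix m n 𝕜) (c : ℝ), (∀ i j, ‖B i j‖ ≤ c) → 0 ≤ c → ‖B‖ ≤ C * c := by
  -- The `+ 1` keeps the constant positive for empty index types.
  refine ⟨∑ i : m, ∑ j : n, ‖(Matrix.single i j 1 : Matrix m n 𝕜)‖ + 1, by positivity, ?_⟩
  intro B c hB hc
  have h : ‖B‖ ≤ ∑ i : m, ∑ j : n, c * ‖(Matrix.single i j 1 : Matrix m n 𝕜)‖ := by
    conv_lhs => rw [Matrix.matrix_eq_sum_single B]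
    refine norm_sum_le_of_le _ fun i _ => norm_sum_le_of_le _ fun j _ => ?_
    have : Matrix.single i j (B i j) = B i j • (Matrix.single i j 1 : Matrix m n 𝕜) := by
      simp
    rw [this, norm_smul]
    exact mul_le_mul_of_nonneg_right (hB i j) (norm_nonneg _)
  simp only [← Finset.mul_sum] at h
  linarith

variable {n N : ℕ} {w : Fin N → ℝ} {M : Fin N → Matrix (Fin n) (Fin n) ℝ}

/-- The word weights sum to `1`, so each entry is an average of numbers of modulus at most `c ^ p`.
-/
theorem exists_norm_sum_smul_kroneckerPower_pow_le (hw : ∀ i, 0 < w i) (hw1 : ∑ i, w i = 1)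
    (p : ℕ) :
    ∃ D : ℝ, 0 < D ∧ ∀ (k : ℕ) (c : ℝ), 0 ≤ c →
      (∀ f : Fin k → Fin N, ‖(List.ofFn fun t => M (f t)).prod‖ ≤ c) →
      ‖((∑ i, w i • kroneckerPower (M i) p).map (algebraMap ℝ ℂ)) ^ k‖ ≤ D * c ^ p := by
  obtain ⟨D, hD, h⟩ := Matrix.exists_l2_opNorm_le_of_entry_le ℂ (Fin (n ^ p)) (Fin (n ^ p))
  refine ⟨D, hD, fun k c hc hf => h _ _ (fun i j => ?_) (by positivity)⟩
  rw [← Matrix.map_pow, Matrix.map_apply, norm_algebraMap', sum_smul_kroneckerPower_pow,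
    Matrix.sum_apply]
  have hs : ∑ f : Fin k → Fin N, ∏ t, w (f t) = 1 := by
    rw [← Fintype.sum_pow, hw1, one_pow]
  calc ‖∑ f : Fin k → Fin N, ((∏ t, w (f t)) •
        kroneckerPower (List.ofFn fun t => M (f t)).prod p) i j‖
      ≤ ∑ f : Fin k → Fin N, (∏ t, w (f t)) * c ^ p := by
        refine norm_sum_le_of_le _ fun f _ => ?_
        have hpos : 0 ≤ ∏ t, w (f t) := Finset.prod_nonneg fun t _ => (hw _).le
        rw [Matrix.smul_apply, norm_smul, Real.norm_of_nonneg hpos]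
        refine mul_le_mul_of_nonneg_left ?_ hpos
        exact abs_kroneckerPower_apply_le
          (fun a b => (Matrix.norm_entry_le_l2_opNorm _ a b).trans (hf f)) p i j
    _ = c ^ p := by rw [← Finset.sum_mul, hs, one_mul]

/-- At the indices `(i, …, i)`, `(j, …, j)` every word contributes a nonnegative `p`-th power, so
one word is bounded by the whole sum. -/
theorem exists_pow_mul_norm_prod_pow_le (hw : ∀ i, 0 < w i) {v : ℝ} (hv : 0 ≤ v)
    (hvw : ∀ i, v ≤ w i) {p : ℕ} (hp : Even p) (hp0 : p ≠ 0) :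
    ∃ D : ℝ, 0 < D ∧ ∀ (k : ℕ) (f : Fin k → Fin N),
      v ^ k * ‖(List.ofFn fun t => M (f t)).prod‖ ^ p ≤
        D * ‖((∑ i, w i • kroneckerPower (M i) p).map (algebraMap ℝ ℂ)) ^ k‖ := by
  obtain ⟨C, hC, h⟩ := Matrix.exists_l2_opNorm_le_of_entry_le ℝ (Fin n) (Fin n)
  refine ⟨C ^ p, by positivity, fun k f => ?_⟩
  set Q := (List.ofFn fun t => M (f t)).prod with hQ
  set R := ‖((∑ i, w i • kroneckerPower (M i) p).map (algebraMap ℝ ℂ)) ^ k‖ with hR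
  have key : ∀ i j, v ^ k * |Q i j| ^ p ≤ R := by
    intro i j
    have hprod : v ^ k ≤ ∏ t, w (f t) := by
      simpa using Finset.prod_le_prod (s := Finset.univ) (f := fun _ : Fin k => v)
        (fun _ _ => hv) (fun t _ => hvw (f t))
    refine le_trans ?_ (Matrix.norm_entry_le_l2_opNorm _ (kroneckerDiagIndex i p)
      (kroneckerDiagIndex j p))
    rw [← Matrix.map_pow, Matrix.map_apply, norm_algebraMap', sum_smul_kroneckerPower_pow,
      Matrix.sum_apply]
    refine le_trans ?_ (Real.le_norm_self _)
    simp only [Matrix.smul_apply, kroneckerPower_kroneckerDiagIndex, smul_eq_mul]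
    refine le_trans ?_ (Finset.single_le_sum (fun g _ => ?_) (Finset.mem_univ f))
    · rw [hp.pow_abs]
      exact mul_le_mul_of_nonneg_right hprod (hp.pow_nonneg _)
    · exact mul_nonneg (Finset.prod_nonneg fun t _ => (hw _).le) (hp.pow_nonneg _)
  -- For `n = 0` there is no largest entry to pick.
  obtain rfl | n0 := n.eq_zero_or_pos
  · have : Q = 0 := Subsingleton.elim _ _
    rw [this, norm_zero, zero_pow hp0, mul_zero]
    positivity
  have : Nonempty (Fin n × Fin n) := ⟨⟨0, n0⟩, ⟨0, n0⟩⟩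
  obtain ⟨a, ha⟩ := Finite.exists_max fun a : Fin n × Fin n => |Q a.1 a.2|
  have hb := h Q _ (fun i j => ha (i, j)) (abs_nonneg _)
  calc v ^ k * ‖Q‖ ^ p ≤ v ^ k * (C * |Q a.1 a.2|) ^ p := by gcongr
    _ = C ^ p * (v ^ k * |Q a.1 a.2| ^ p) := by ring
    _ ≤ C ^ p * R := by gcongr; exact key _ _

end NormBounds

/-! ### Passing to `k`-th roots -/

section RootLimits

theorem ENNReal.tendsto_const_rpow_one_div {D : ℝ≥0∞} (h0 : D ≠ 0) (ht : D ≠ ∞) {u : ℕ → ℝ}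
    (hu : Tendsto u atTop atTop) :
    Tendsto (fun k => D ^ (1 / u k)) atTop (nhds 1) := by
  have hd : 0 < D.toReal := ENNReal.toReal_pos h0 ht
  have h1 : Tendsto (fun k => D.toReal ^ (1 / u k)) atTop (nhds 1) := by
    have h2 : Tendsto (fun k => 1 / u k) atTop (nhds 0) := tendsto_const_nhds.div_atTop hu
    simpa [Function.comp_def] using (Real.continuousAt_const_rpow hd.ne').tendsto.comp h2
  have h3 := ENNReal.tendsto_ofReal h1
  rw [ENNReal.ofReal_one] at h3
  refine h3.congr fun k => ?_
  rw [← ENNReal.ofReal_rpow_of_pos hd, ENNReal.ofReal_toReal ht]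

variable {a s : ℕ → ℝ≥0∞} {ρ D : ℝ≥0∞} {q : ℝ}

theorem rpow_le_limsup_of_le_mul_rpow
    (ha : Tendsto (fun k : ℕ => a k ^ (1 / (k : ℝ))) atTop (nhds ρ)) (hD0 : D ≠ 0) (hDt : D ≠ ∞)
    (hq : 0 < q) (h : ∀ k, a k ≤ D * s k ^ q) :
    ρ ^ (1 / q) ≤ limsup (fun k : ℕ => s k ^ (1 / (k : ℝ))) atTop := by
  have h1 := ENNReal.Tendsto.mul (ENNReal.tendsto_const_rpow_one_div (D := D⁻¹) (by simpa)
    (by simpa) tendsto_natCast_atTop_atTop) (Or.inl one_ne_zero) ha (Or.inr ENNReal.one_ne_top)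
  rw [one_mul] at h1
  have h2 := h1.ennrpow_const (1 / q)
  rw [← h2.limsup_eq]
  refine limsup_le_limsup (Eventually.of_forall fun k => ?_)
  have hk : (0 : ℝ) ≤ 1 / (k : ℝ) := by positivity
  have h3 : D⁻¹ * a k ≤ s k ^ q := by
    rw [ENNReal.inv_mul_le_iff hD0 hDt]
    exact h k
  calc (D⁻¹ ^ (1 / (k : ℝ)) * a k ^ (1 / (k : ℝ))) ^ (1 / q)
      = ((D⁻¹ * a k) ^ (1 / (k : ℝ))) ^ (1 / q) := by rw [ENNReal.mul_rpow_of_nonneg _ _ hk]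
    _ ≤ ((s k ^ q) ^ (1 / (k : ℝ))) ^ (1 / q) := by gcongr
    _ = s k ^ (1 / (k : ℝ)) := by
      rw [← ENNReal.rpow_mul, ← ENNReal.rpow_mul]
      congr 1
      field_simp

theorem limsup_le_rpow_of_pow_mul_rpow_le {v : ℝ≥0∞}
    (ha : Tendsto (fun k : ℕ => a k ^ (1 / (k : ℝ))) atTop (nhds ρ)) (hD0 : D ≠ 0) (hDt : D ≠ ∞)
    (hv0 : v ≠ 0) (hvt : v ≠ ∞) (hq : 0 < q) (h : ∀ k, v ^ k * s k ^ q ≤ D * a k) :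
    v ^ (1 / q) * limsup (fun k : ℕ => s k ^ (1 / (k : ℝ))) atTop ≤ ρ ^ (1 / q) := by
  have hq' : 0 ≤ 1 / q := by positivity
  have h1 := ENNReal.Tendsto.mul (ENNReal.tendsto_const_rpow_one_div hD0
    hDt tendsto_natCast_atTop_atTop) (Or.inl one_ne_zero) ha (Or.inr ENNReal.one_ne_top)
  rw [one_mul] at h1
  have h2 := (ENNReal.Tendsto.const_mul (a := v⁻¹) h1 (Or.inr (by simpa))).ennrpow_const (1 / q)
  have h4 : limsup (fun k : ℕ => s k ^ (1 / (k : ℝ))) atTop ≤ (v⁻¹ * ρ) ^ (1 / q) := by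
    rw [← h2.limsup_eq]
    -- At `k = 0` the exponent `1 / k` is `0`, and the `k`-th root of `v⁻¹ ^ k` is not `v⁻¹`.
    refine limsup_le_limsup ((eventually_gt_atTop 0).mono fun k hk0 => ?_)
    have hk : (0 : ℝ) ≤ 1 / (k : ℝ) := by positivity
    have hk0' : (k : ℝ) ≠ 0 := by positivity
    have h3 : s k ^ q ≤ (v⁻¹) ^ k * (D * a k) := by
      rw [← ENNReal.inv_pow, mul_comm, ← div_eq_mul_inv,
        ENNReal.le_div_iff_mul_le (Or.inl (pow_ne_zero _ hv0)) (Or.inl (ENNReal.pow_ne_top hvt)),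
        mul_comm]
      exact h k
    calc s k ^ (1 / (k : ℝ)) = ((s k ^ q) ^ (1 / (k : ℝ))) ^ (1 / q) := by
          rw [← ENNReal.rpow_mul, ← ENNReal.rpow_mul]
          congr 1
          field_simp
      _ ≤ (((v⁻¹) ^ k * (D * a k)) ^ (1 / (k : ℝ))) ^ (1 / q) := by gcongr
      _ = (v⁻¹ * (D ^ (1 / (k : ℝ)) * a k ^ (1 / (k : ℝ)))) ^ (1 / q) := by
          rw [ENNReal.mul_rpow_of_nonneg _ _ hk, ENNReal.mul_rpow_of_nonneg _ _ hk,
            ← ENNReal.rpow_natCast, ← ENNReal.rpow_mul, mul_one_div_cancel hk0', ENNReal.rpow_one]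
  rw [ENNReal.mul_rpow_of_nonneg _ _ hq', ENNReal.inv_rpow] at h4
  have hv0' : v ^ (1 / q) ≠ 0 := by simp [ENNReal.rpow_eq_zero_iff, hv0, hvt]
  have hvt' : v ^ (1 / q) ≠ ∞ := ENNReal.rpow_ne_top_of_nonneg hq' hvt
  rwa [mul_comm, ← ENNReal.le_div_iff_mul_le (Or.inl hv0') (Or.inl hvt'), div_eq_mul_inv,
    mul_comm]

end RootLimits

/-! ### Comparison with the joint spectral radius -/

section JointSpectralRadius

open scoped Matrix.Norms.L2Operator

variable {n N : ℕ}

/-- The largest norm of a product of `k` factors from a finite family of matrices. -/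
noncomputable def maxNormProd (M : Fin N → Matrix (Fin n) (Fin n) ℝ) (k : ℕ) : ℝ≥0∞ :=
  ⨆ f : Fin k → Fin N, ‖(List.ofFn fun t => M (f t)).prod‖ₑ

variable {M : Fin N → Matrix (Fin n) (Fin n) ℝ}

theorem maxNormProd_ne_top (k : ℕ) : maxNormProd M k ≠ ∞ := by
  rw [maxNormProd]
  refine (lt_of_le_of_lt (iSup_le fun f => Finset.single_le_sum
    (f := fun f : Fin k → Fin N => ‖(List.ofFn fun t => M (f t)).prod‖ₑ)
    (fun _ _ => zero_le) (Finset.mem_univ f)) ?_).ne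
  exact ENNReal.sum_lt_top.2 fun _ _ => enorm_lt_top

theorem jointSpectralRadius_range :
    jointSpectralRadius (Set.range M) =
      limsup (fun k : ℕ => maxNormProd M k ^ (1 / (k : ℝ))) atTop := by
  rw [jointSpectralRadius]
  refine limsup_congr ((eventually_gt_atTop 0).mono fun k hk => ?_)
  have hk' : (0 : ℝ) < 1 / (k : ℝ) := by positivity
  -- A positive power is an order isomorphism of `ℝ≥0∞`, so it commutes with the supremum.
  have := (ENNReal.orderIsoRpow (1 / (k : ℝ)) hk').map_iSup
    fun f : Fin k → Fin N => ‖(List.ofFn fun t => M (f t)).prod‖ₑ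
  simp only [ENNReal.orderIsoRpow_apply] at this
  rw [maxNormProd, this]
  refine (Function.Surjective.iSup_congr
    (fun (f : Fin k → Fin N) t => (⟨M (f t), f t, rfl⟩ : Set.range M)) (fun A => ?_)
    fun f => rfl).symm
  choose f hf using fun t => (A t).2
  exact ⟨f, funext fun t => Subtype.ext (hf t)⟩

theorem norm_prod_ofFn_le {c : ℝ} (hM : ∀ i, ‖M i‖ ≤ c) {k : ℕ} (hk : 0 < k)
    (f : Fin k → Fin N) : ‖(List.ofFn fun t => M (f t)).prod‖ ≤ c ^ k := by
  refine (List.norm_prod_le' (by simpa [List.ofFn_eq_nil_iff] using hk.ne')).trans ?_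
  rw [List.map_ofFn, List.prod_ofFn]
  simpa using Finset.prod_le_prod (s := Finset.univ) (g := fun _ : Fin k => c)
    (fun t _ => norm_nonneg (M (f t))) fun t _ => hM (f t)

theorem jointSpectralRadius_range_ne_top : jointSpectralRadius (Set.range M) ≠ ∞ := by
  have hM : ∀ i, ‖M i‖ ≤ ∑ j, ‖M j‖ := fun i =>
    Finset.single_le_sum (f := fun j => ‖M j‖) (fun _ _ => norm_nonneg _) (Finset.mem_univ i)
  have hc : 0 ≤ ∑ j, ‖M j‖ := Finset.sum_nonneg fun _ _ => norm_nonneg _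
  refine (lt_of_le_of_lt ?_ (ENNReal.ofReal_lt_top (r := ∑ j, ‖M j‖))).ne
  rw [jointSpectralRadius_range]
  refine limsup_le_of_le (h := (eventually_gt_atTop 0).mono fun k hk => ?_)
  have hk' : (k : ℝ) ≠ 0 := by positivity
  calc maxNormProd M k ^ (1 / (k : ℝ)) ≤ (ENNReal.ofReal (∑ j, ‖M j‖) ^ k) ^ (1 / (k : ℝ)) := by
        gcongr
        refine iSup_le fun f => ?_
        rw [← ENNReal.ofReal_pow hc, ← ofReal_norm]
        exact ENNReal.ofReal_le_ofReal (norm_prod_ofFn_le hM hk f)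
    _ = _ := by
        rw [← ENNReal.rpow_natCast, ← ENNReal.rpow_mul, mul_one_div_cancel hk', ENNReal.rpow_one]

/-- Gelfand's formula. -/
theorem tendsto_enorm_pow_matrixSpectralRadius {m : ℕ} (B : Matrix (Fin m) (Fin m) ℝ) :
    Tendsto (fun k : ℕ => ‖(B.map (algebraMap ℝ ℂ)) ^ k‖ₑ ^ (1 / (k : ℝ))) atTop
      (nhds (matrixSpectralRadius B)) :=
  haveI : CompleteSpace (Matrix (Fin m) (Fin m) ℂ) := FiniteDimensional.complete ℂ _
  spectrum.pow_nnnorm_pow_one_div_tendsto_nhds_spectralRadius (B.map (algebraMap ℝ ℂ))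

variable {w : Fin N → ℝ}

theorem matrixSpectralRadius_rpow_le_jointSpectralRadius (hw : ∀ i, 0 < w i)
    (hw1 : ∑ i, w i = 1) {p : ℕ} (hp : 0 < p) :
    matrixSpectralRadius (∑ i, w i • kroneckerPower (M i) p) ^ (1 / (p : ℝ)) ≤
      jointSpectralRadius (Set.range M) := by
  obtain ⟨D, hD, h⟩ := exists_norm_sum_smul_kroneckerPower_pow_le (M := M) hw hw1 p
  rw [jointSpectralRadius_range]
  refine rpow_le_limsup_of_le_mul_rpow (tendsto_enorm_pow_matrixSpectralRadius _)
    (D := ENNReal.ofReal D) (by simpa using hD) ENNReal.ofReal_ne_top (by positivity) fun k => ?_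
  have := h k (maxNormProd M k).toReal ENNReal.toReal_nonneg fun f => by
    rw [← toReal_enorm]
    exact ENNReal.toReal_mono (maxNormProd_ne_top k)
      (le_iSup (fun f : Fin k → Fin N => ‖(List.ofFn fun t => M (f t)).prod‖ₑ) f)
  rw [← ofReal_norm]
  refine (ENNReal.ofReal_le_ofReal this).trans (le_of_eq ?_)
  rw [ENNReal.ofReal_mul hD.le, ENNReal.ofReal_pow ENNReal.toReal_nonneg,
    ENNReal.ofReal_toReal (maxNormProd_ne_top k), ENNReal.rpow_natCast]

theorem rpow_mul_jointSpectralRadius_le (hw : ∀ i, 0 < w i) {v : ℝ} (hv : 0 < v)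
    (hvw : ∀ i, v ≤ w i) {p : ℕ} (hp : Even p) (hp0 : 0 < p) :
    ENNReal.ofReal v ^ (1 / (p : ℝ)) * jointSpectralRadius (Set.range M) ≤
      matrixSpectralRadius (∑ i, w i • kroneckerPower (M i) p) ^ (1 / (p : ℝ)) := by
  obtain ⟨D, hD, h⟩ := exists_pow_mul_norm_prod_pow_le (M := M) hw hv.le hvw hp hp0.ne'
  rw [jointSpectralRadius_range]
  refine limsup_le_rpow_of_pow_mul_rpow_le (tendsto_enorm_pow_matrixSpectralRadius _)
    (D := ENNReal.ofReal D) (by simpa using hD) ENNReal.ofReal_ne_top (by simpa using hv)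
    ENNReal.ofReal_ne_top (by positivity) fun k => ?_
  have hp' : (0 : ℝ) < p := by positivity
  have := (ENNReal.orderIsoRpow (p : ℝ) hp').map_iSup
    fun f : Fin k → Fin N => ‖(List.ofFn fun t => M (f t)).prod‖ₑ
  simp only [ENNReal.orderIsoRpow_apply] at this
  rw [maxNormProd, this, ENNReal.mul_iSup]
  refine iSup_le fun f => ?_
  rw [← ofReal_norm, ← ofReal_norm, ENNReal.rpow_natCast,
    ← ENNReal.ofReal_pow hv.le, ← ENNReal.ofReal_pow (norm_nonneg _),
    ← ENNReal.ofReal_mul (by positivity), ← ENNReal.ofReal_mul hD.le]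
  exact ENNReal.ofReal_le_ofReal (h k f)

end JointSpectralRadius

theorem mainTheorem3 {n : ℕ}
    (μ : Measure (Matrix (Fin n) (Fin n) ℝ)) [IsProbabilityMeasure μ]
    {N : ℕ} (w : Fin N → ℝ) (hw : ∀ i, 0 < w i) (M : Fin N → Matrix (Fin n) (Fin n) ℝ)
    (hμ : μ = ∑ i, ENNReal.ofReal (w i) • Measure.dirac (M i))
    {Ω : Type*} [MeasurableSpace Ω] (P : Measure Ω) [IsProbabilityMeasure P]
    (A : Ω → Matrix (Fin n) (Fin n) ℝ) (hA : HasLaw A μ P) :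
    jointSpectralRadius μ.support ≠ ∞ ∧
    Tendsto (fun p : ℕ =>
        matrixSpectralRadius (expectedKroneckerPower P A (2 * p)) ^ (1 / (2 * (p : ℝ))))
      atTop (nhds (jointSpectralRadius μ.support)) ∧
    limsup (fun p : ℕ =>
        matrixSpectralRadius (expectedKroneckerPower P A p) ^ (1 / (p : ℝ))) atTop
      = jointSpectralRadius μ.support := by
  have hw1 := sum_weights_eq_one hw hμ
  rw [support_sum_smul_dirac hw hμ]
  simp only [expectedKroneckerPower_eq_sum hw hμ hA]
  set J := jointSpectralRadius (Set.range M) with hJ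
  have hJt : J ≠ ∞ := jointSpectralRadius_range_ne_top
  have hle : ∀ p : ℕ, 0 < p →
      matrixSpectralRadius (∑ i, w i • kroneckerPower (M i) p) ^ (1 / (p : ℝ)) ≤ J :=
    fun p hp => matrixSpectralRadius_rpow_le_jointSpectralRadius hw hw1 hp
  have hN : Nonempty (Fin N) := by
    by_contra hN
    rw [not_nonempty_iff] at hN
    simp at hw1
  -- The least weight `w i₀` serves as `v`.
  obtain ⟨i₀, hi₀⟩ := Finite.exists_min w
  have hlim : Tendsto (fun p : ℕ =>
      matrixSpectralRadius (∑ i, w i • kroneckerPower (M i) (2 * p)) ^ (1 / (2 * (p : ℝ))))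
      atTop (nhds J) := by
    have hv := ENNReal.tendsto_const_rpow_one_div (D := ENNReal.ofReal (w i₀))
      (by simpa using hw i₀) ENNReal.ofReal_ne_top
      (tendsto_natCast_atTop_atTop.const_mul_atTop (zero_lt_two' ℝ))
    have hl := ENNReal.Tendsto.mul_const hv (b := J) (Or.inr hJt)
    rw [one_mul] at hl
    refine tendsto_of_tendsto_of_tendsto_of_le_of_le' hl tendsto_const_nhds
      ((eventually_gt_atTop 0).mono fun p hp => ?_) ((eventually_gt_atTop 0).mono fun p hp => ?_)
    · simpa using rpow_mul_jointSpectralRadius_le (M := M) hw (hw i₀) hi₀ (even_two_mul p)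
        (by positivity)
    · simpa using hle (2 * p) (by positivity)
  refine ⟨hJt, hlim, le_antisymm ?_ ?_⟩
  · exact limsup_le_of_le (h := (eventually_gt_atTop 0).mono hle)
  -- The limit along even `p` bounds the full limsup from below.
  · have ht : Tendsto (fun p : ℕ => 2 * p) atTop atTop :=
      tendsto_id.const_mul_atTop' two_pos
    rw [← hlim.limsup_eq]
    refine le_trans (le_of_eq ?_) (limsup_le_limsup_of_le ht)
    simp [limsup, Filter.map_map, Function.comp_def]
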